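/- Let $\mathcal W$ be the space of real $2\pi$-periodic functions $u\in H^1(-\pi,\pi)$ (identified with their continuous $2\pi$-periodic representatives on $\mathbb R$) such that $$\int_{-\pi}^{\pi}u\,d\theta=\int_{-\pi}^{\pi}u\cos\theta\,d\theta=\int_{-\pi}^{\pi}u\sin\theta\,d\theta=0 ,$$ and for $u\in\mathcal W\setminus\{0\}$ let $$J(u)=\frac{\int_{-\pi}^{\pi}\left[(u')^2-u^2\right]d\theta}{\left[\int_{-\pi}^{\pi}|u|\,d\theta\right]^2}.$$ Let $u\in\mathcal W\setminus\{0\}$ be a minimizer of $J$ over $\mathcal W\setminus\{0\}$. Then every nodal interval of $u$ has length strictly less than $\pi$: if $a<b$ are real numbers such that $u\ge 0$ on the whole of $(a,b)$ or $u\le 0$ on the whole of $(a,b)$ (zeros of $u$ inside $(a,b)$ are allowed), then $b-a<\pi$. -/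

import Mathlib

open Real Set MeasureTheory
open scoped ContDiff

noncomputable section

namespace WirtingerL1

/-- Lebesgue measure on the interval `(-π, π)`. -/
def volPi : Measure ℝ := volume.restrict (Ioo (-π) π)

/-- `g` is a weak derivative of `u` on `(-π, π)`: for every smooth test function `φ` with compact
support contained in `(-π, π)`, `∫ u φ' = - ∫ g φ`. (It is only used together with `u, g ∈ L²`, so
that all the integrals converge.) -/
def IsWeakDeriv (u g : ℝ → ℝ) : Prop :=
  ∀ φ : ℝ → ℝ, ContDiff ℝ ∞ φ → HasCompactSupport φ → tsupport φ ⊆ Ioo (-π) π →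
    ∫ x, u x * deriv φ x ∂volPi = - ∫ x, g x * φ x ∂volPi

/-- `u` belongs to the Sobolev space `H¹(-π, π)`. -/
def MemH1 (u : ℝ → ℝ) : Prop :=
  MemLp u 2 volPi ∧ ∃ g : ℝ → ℝ, MemLp g 2 volPi ∧ IsWeakDeriv u g

open Classical in
/-- The weak derivative of `u ∈ H¹(-π, π)`, which is unique up to a null set (and `0` if `u` is not
in `H¹`). -/
def weakDeriv (u : ℝ → ℝ) : ℝ → ℝ :=
  if h : MemH1 u then h.2.choose else 0

/-- The defining property of `weakDeriv`. -/
theorem weakDeriv_spec {u : ℝ → ℝ} (h : MemH1 u) :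
    MemLp (weakDeriv u) 2 volPi ∧ IsWeakDeriv u (weakDeriv u) := by
  rw [weakDeriv, dif_pos h]
  exact h.2.choose_spec

/-- The space `𝒲` of `2π`-periodic functions in `H¹(-π, π)` (represented, as is always possible and
in exactly one way, by a continuous `2π`-periodic function on the line) that satisfy the
constraints (L1), (L2), (L3). -/
structure MemW (u : ℝ → ℝ) : Prop where
  continuous : Continuous u
  periodic : Function.Periodic u (2 * π)
  memH1 : MemH1 u
  integral_eq_zero : ∫ x, u x ∂volPi = 0
  integral_mul_cos_eq_zero : ∫ x, u x * cos x ∂volPi = 0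
  integral_mul_sin_eq_zero : ∫ x, u x * sin x ∂volPi = 0

/-- The functional `J(u) = ∫ (u'² - u²) / (∫ |u|)²`, the integrals being over `(-π, π)`. -/
def J (u : ℝ → ℝ) : ℝ :=
  (∫ x, ((weakDeriv u x) ^ 2 - (u x) ^ 2) ∂volPi) / (∫ x, |u x| ∂volPi) ^ 2

/-- The functions on which `J` is minimized: the nonzero elements of `𝒲` (for `u = 0` the quotient
`J(u)` is not defined). -/
def admissible : Set (ℝ → ℝ) := {u | MemW u ∧ u ≠ 0}

/-- `u` is a minimizer of `J`: it is admissible and `J u ≤ J v` for all admissible `v`. -/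
def IsMinimizer (u : ℝ → ℝ) : Prop := u ∈ admissible ∧ IsMinOn J admissible u

/-- `(a, b)` is an interval on which `u` has a constant sign, where `u` may vanish at some points
in the interior. Maximality is not part of the definition, so that the maximal intervals of
constant sign are included, as are the connected components of `{u ≠ 0}`. The interval is an
interval of the real line, so it may contain odd multiples of `π`. -/
def IsNodalInterval (u : ℝ → ℝ) (a b : ℝ) : Prop :=
  a < b ∧ ((∀ x ∈ Ioo a b, 0 ≤ u x) ∨ (∀ x ∈ Ioo a b, u x ≤ 0))

end WirtingerL1

end

namespace WirtingerL1
open Filter Topology intervalIntegral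

/-! Suppose `u` has constant sign on an interval of length at least `π`, and let `U = ∫ u²`. Three
estimates are then incompatible. The constraints remove the Fourier modes `|n| ≤ 1`, so Parseval
gives `∫ u'² ≥ 4U` (`MemW.four_mul_integral_sq_le`) and the numerator of `J u` is at least `3U`. The
competitor `cos 2x` gives `J u ≤ 3π/16` by minimality (`J_cos_two_mul`). The long sign interval
improves Cauchy–Schwarz from `(∫ |u|)² ≤ 2πU` to `(∫ |u|)² ≤ (2π - 16/(3π)) U`
(`integral_abs_sq_le`): `sign u` may be corrected by a multiple of `1 + sin (x - a)`, which is
orthogonal to `u`. Together, `3U ≤ (3π²/8 - 1) U`, that is `π² ≥ 32/3`, which is false. -/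

lemma integral_volPi {E : Type*} [NormedAddCommGroup E] [NormedSpace ℝ E] (f : ℝ → E) :
    ∫ x, f x ∂volPi = ∫ x in (-π)..π, f x := by
  rw [integral_of_le (by linarith [pi_pos]), integral_Ioc_eq_integral_Ioo, volPi]

/-! ### The `L¹`–`L²` bound under a long sign interval -/

/-- A weighted pointwise estimate integrates to a bound on the `L¹` norm of a function
that is nonnegative on a half period and orthogonal to `1 + sin (x - a)`. -/
lemma two_mul_integral_abs_le {u : ℝ → ℝ} {a : ℝ} (hc : Continuous u)
    (hk : ∫ x in a..(a + 2 * π), u x * (1 + sin (x - a)) = 0)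
    (h0 : ∀ x ∈ Ioo a (a + π), 0 ≤ u x) {t : ℝ} (ht : 0 ≤ t) :
    2 * t * ∫ x in a..(a + 2 * π), |u x| ≤
      t ^ 2 * (2 * π - 16 / (3 * π)) + ∫ x in a..(a + 2 * π), u x ^ 2 := by
  have hpi := pi_pos
  -- The squared weights below have total integral `2π - 8c + 3πc²`; this `c` minimizes it, with
  -- value `2π - 16/(3π)`.
  obtain ⟨c, hcdef⟩ : ∃ c, c = 4 / (3 * π) := ⟨_, rfl⟩
  have hc0 : 0 < c := by rw [hcdef]; positivity
  have hcpi : c * π = 4 / 3 := by rw [hcdef]; field_simp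
  have hc1 : 2 * c ≤ 1 := by nlinarith [pi_gt_three]
  -- By orthogonality, a multiple of `u (1 + sin (x - a))` can be subtracted at no cost.
  have key : ∫ x in a..(a + 2 * π), (2 * t * |u x| - u x ^ 2) =
      (∫ x in a..(a + π), (2 * t * (|u x| - c * (u x * (1 + sin (x - a)))) - u x ^ 2)) +
      ∫ x in (a + π)..(a + 2 * π), (2 * t * (|u x| - c * (u x * (1 + sin (x - a)))) - u x ^ 2) := by
    rw [integral_add_adjacent_intervals (Continuous.intervalIntegrable (by fun_prop) _ _)
      (Continuous.intervalIntegrable (by fun_prop) _ _)]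
    have : ∀ x, 2 * t * (|u x| - c * (u x * (1 + sin (x - a)))) - u x ^ 2 =
      (2 * t * |u x| - u x ^ 2) - (2 * t * c) * (u x * (1 + sin (x - a))) := fun x => by ring
    simp_rw [this]
    rw [integral_sub (f := fun x => 2 * t * |u x| - u x ^ 2)
      (g := fun x => 2 * t * c * (u x * (1 + sin (x - a))))
      (Continuous.intervalIntegrable (by fun_prop) _ _)
      (Continuous.intervalIntegrable (by fun_prop) _ _), intervalIntegral.integral_const_mul
        (2 * t * c), hk]
    ring
  have b1 : ∫ x in a..(a + π), (2 * t * (|u x| - c * (u x * (1 + sin (x - a)))) - u x ^ 2) ≤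
      ∫ x in a..(a + π), t ^ 2 * (1 - c - c * sin (x - a)) ^ 2 := by
    refine integral_mono_on_of_le_Ioo (by linarith)
      (Continuous.intervalIntegrable (by fun_prop) _ _)
      (Continuous.intervalIntegrable (by fun_prop) _ _) fun x hx => ?_
    rw [abs_of_nonneg (h0 x hx)]
    nlinarith [sq_nonneg (t * (1 - c - c * sin (x - a)) - u x)]
  -- The sign of `u` is unknown here; since `1 + sin ≥ 0`, the worst case is `u ≤ 0`, which gives
  -- the weight `1 + c + c sin`.
  have b2 : ∫ x in (a + π)..(a + 2 * π),
        (2 * t * (|u x| - c * (u x * (1 + sin (x - a)))) - u x ^ 2) ≤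
      ∫ x in (a + π)..(a + 2 * π), t ^ 2 * (1 + c + c * sin (x - a)) ^ 2 := by
    refine integral_mono_on (by linarith) (Continuous.intervalIntegrable (by fun_prop) _ _)
      (Continuous.intervalIntegrable (by fun_prop) _ _) fun x hx => ?_
    have h1 : 0 ≤ c * (1 + sin (x - a)) := mul_nonneg hc0.le (by linarith [neg_one_le_sin (x - a)])
    have h2 : -(c * (u x * (1 + sin (x - a)))) ≤ |u x| * (c * (1 + sin (x - a))) := by
      nlinarith [neg_abs_le (u x), mul_le_mul_of_nonneg_right (neg_abs_le (u x)) h1]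
    have h3 := mul_le_mul_of_nonneg_left h2 ht
    nlinarith [sq_nonneg (t * (1 + c + c * sin (x - a)) - |u x|), sq_abs (u x)]
  have prim : ∀ p q s e : ℝ, ∫ x in p..q, t ^ 2 * (s + e * sin (x - a)) ^ 2 =
      t ^ 2 * ((s ^ 2 + e ^ 2 / 2) * (q - p) - 2 * s * e * (cos (q - a) - cos (p - a))
        - e ^ 2 / 2 * (sin (q - a) * cos (q - a) - sin (p - a) * cos (p - a))) := by
    intro p q s e
    have hd : ∀ x ∈ uIcc p q, HasDerivAt (fun x => t ^ 2 * ((s ^ 2 + e ^ 2 / 2) * x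
        - 2 * s * e * cos (x - a) - e ^ 2 / 2 * (sin (x - a) * cos (x - a))))
        (t ^ 2 * (s + e * sin (x - a)) ^ 2) x := by
      intro x _
      have hx := (hasDerivAt_id x).sub_const a
      have h := ((((hasDerivAt_id x).const_mul (s ^ 2 + e ^ 2 / 2)).sub
        (hx.cos.const_mul (2 * s * e))).sub ((hx.sin.mul hx.cos).const_mul (e ^ 2 / 2))).const_mul
        (t ^ 2)
      refine h.congr_deriv ?_
      simp only [id]
      linear_combination (-(t ^ 2 * e ^ 2 / 2)) * sin_sq_add_cos_sq (x - a)
    rw [integral_eq_sub_of_hasDerivAt hd (Continuous.intervalIntegrable (by fun_prop) _ _)]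
    ring
  have p1 := prim a (a + π) (1 - c) (-c)
  have p2 := prim (a + π) (a + 2 * π) (1 + c) c
  simp only [neg_mul, ← sub_eq_add_neg] at p1
  simp only [add_sub_cancel_left, sub_self, sin_pi, cos_pi, cos_zero, sin_zero, cos_two_pi,
    sin_two_pi] at p1 p2
  rw [integral_sub (Continuous.intervalIntegrable (by fun_prop) _ _)
      (Continuous.intervalIntegrable (by fun_prop) _ _), intervalIntegral.integral_const_mul] at key
  have e : 16 / (3 * π) = 4 * c := by rw [hcdef]; ring
  rw [e]
  rw [p1] at b1
  rw [p2] at b2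
  have : 3 * π * c ^ 2 = 4 * c := by linear_combination 3 * c * hcpi
  nlinarith [this]

/-- The kernel `1 + sin (x - a)` lies in the span of `1`, `cos`, `sin`, so `two_mul_integral_abs_le`
applies after a shift of the period; it remains to optimize over `t`. -/
lemma integral_abs_sq_le {u : ℝ → ℝ} {a : ℝ} (hc : Continuous u)
    (hp : Function.Periodic u (2 * π))
    (h1 : ∫ x in (-π)..π, u x = 0) (h2 : ∫ x in (-π)..π, u x * cos x = 0)
    (h3 : ∫ x in (-π)..π, u x * sin x = 0) (h0 : ∀ x ∈ Ioo a (a + π), 0 ≤ u x) :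
    (∫ x in (-π)..π, |u x|) ^ 2 ≤ (2 * π - 16 / (3 * π)) * ∫ x in (-π)..π, u x ^ 2 := by
  have shift : ∀ f : ℝ → ℝ, Function.Periodic f (2 * π) →
      ∫ x in a..(a + 2 * π), f x = ∫ x in (-π)..π, f x := by
    intro f hf
    rw [hf.intervalIntegral_add_eq a (-π)]
    congr 1; ring
  have hk : ∫ x in a..(a + 2 * π), u x * (1 + sin (x - a)) = 0 := by
    rw [shift _ (fun x => by
      simp only [hp x, show x + 2 * π - a = x - a + 2 * π by ring, sin_add_two_pi])]
    have : ∀ x, u x * (1 + sin (x - a)) =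
        u x + (cos a * (u x * sin x) - sin a * (u x * cos x)) := by
      intro x; rw [sin_sub]; ring
    simp_rw [this]
    rw [integral_add (Continuous.intervalIntegrable (by fun_prop) _ _)
      (Continuous.intervalIntegrable (by fun_prop) _ _),
      integral_sub (Continuous.intervalIntegrable (by fun_prop) _ _)
      (Continuous.intervalIntegrable (by fun_prop) _ _), intervalIntegral.integral_const_mul,
      intervalIntegral.integral_const_mul, h1, h2, h3]
    ring
  have hK : 0 < 2 * π - 16 / (3 * π) := by
    rw [sub_pos, div_lt_iff₀ (by positivity)]
    nlinarith [pi_gt_three]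
  have hA : 0 ≤ ∫ x in (-π)..π, |u x| :=
    integral_nonneg (by linarith [pi_pos]) fun x _ => abs_nonneg _
  set A := ∫ x in (-π)..π, |u x|
  set K := 2 * π - 16 / (3 * π)
  -- `t = A / K` maximizes `2tA - t²K`.
  have h := two_mul_integral_abs_le hc hk h0 (div_nonneg hA hK.le)
  rw [shift (fun x => |u x|) (fun x => by simp only [hp x]),
    shift (fun x => u x ^ 2) (fun x => by simp only [hp x])] at h
  have e1 : 2 * (A / K) * A - (A / K) ^ 2 * K = A ^ 2 / K := by field_simp; ring
  have : A ^ 2 / K ≤ ∫ x in (-π)..π, u x ^ 2 := by rw [← e1]; linarith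
  rwa [div_le_iff₀ hK, mul_comm] at this

/-! ### Cutoffs and integration by parts up to the endpoints -/

instance : IsFiniteMeasure volPi := by unfold volPi; infer_instance

lemma memLp_volPi_of_continuous {f : ℝ → ℝ} (hf : Continuous f) (p : ENNReal) :
    MemLp f p volPi := by
  obtain ⟨C, hC⟩ := isCompact_Icc.exists_bound_of_continuousOn (s := Icc (-π) π) hf.continuousOn
  exact MemLp.of_bound hf.aestronglyMeasurable C ((ae_restrict_iff' measurableSet_Ioo).2
    (ae_of_all _ fun x hx => hC x (Ioo_subset_Icc_self hx)))

/-- A smooth cutoff that vanishes within distance `1 / r` of the endpoints `±π` and equals `1`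
at distance at least `2 / r` from them. -/
noncomputable def cutoff (r x : ℝ) : ℝ :=
  smoothTransition (r * (π - x) - 1) * smoothTransition (r * (x + π) - 1)

lemma contDiff_cutoff (r : ℝ) : ContDiff ℝ ∞ (cutoff r) := by
  unfold cutoff
  exact (smoothTransition.contDiff.comp (by fun_prop)).mul
    (smoothTransition.contDiff.comp (by fun_prop))

lemma cutoff_nonneg (r x : ℝ) : 0 ≤ cutoff r x :=
  mul_nonneg (smoothTransition.nonneg _) (smoothTransition.nonneg _)

lemma cutoff_le_one (r x : ℝ) : cutoff r x ≤ 1 :=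
  mul_le_one₀ (smoothTransition.le_one _) (smoothTransition.nonneg _) (smoothTransition.le_one _)

lemma tsupport_cutoff_subset {r : ℝ} (hr : 0 < r) :
    tsupport (cutoff r) ⊆ Icc (-π + 1 / r) (π - 1 / r) := by
  refine closure_minimal (fun x hx => ?_) isClosed_Icc
  rw [Function.mem_support, cutoff, mul_ne_zero_iff] at hx
  simp only [ne_eq, smoothTransition.zero_iff_nonpos, not_le, sub_pos] at hx
  have h1 : 1 / r < π - x := by rw [div_lt_iff₀ hr]; linarith [hx.1]
  have h2 : 1 / r < x + π := by rw [div_lt_iff₀ hr]; linarith [hx.2]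
  constructor <;> linarith

lemma tendsto_cutoff {x : ℝ} (hx : x ∈ Ioo (-π) π) :
    Tendsto (fun n : ℕ => cutoff n x) atTop (𝓝 1) := by
  have h : ∀ y : ℝ, 0 < y → ∀ᶠ n : ℕ in atTop, smoothTransition (n * y - 1) = 1 := by
    intro y hy
    filter_upwards [(tendsto_natCast_atTop_atTop (R := ℝ)).eventually_ge_atTop (2 / y)] with n hn
    rw [div_le_iff₀ hy] at hn
    exact smoothTransition.one_of_one_le (by linarith)
  refine tendsto_const_nhds.congr' ?_
  filter_upwards [h (π - x) (by linarith [hx.2]), h (x + π) (by linarith [hx.1])] with n h1 h2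
  rw [cutoff, h1, h2, one_mul]

lemma deriv_smoothTransition_nonneg (x : ℝ) : 0 ≤ deriv smoothTransition x :=
  smoothTransition.monotone.deriv_nonneg

lemma deriv_smoothTransition_of_one_lt {x : ℝ} (hx : 1 < x) : deriv smoothTransition x = 0 := by
  have : smoothTransition =ᶠ[𝓝 x] fun _ => 1 := by
    filter_upwards [Ioi_mem_nhds hx] with y hy using smoothTransition.one_of_one_le (le_of_lt hy)
  rw [this.deriv_eq, deriv_const]

lemma hasDerivAt_smoothTransition (x : ℝ) :
    HasDerivAt smoothTransition (deriv smoothTransition x) x :=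
  ((smoothTransition.contDiff (n := 1)).differentiable (by norm_num) x).hasDerivAt

lemma continuous_deriv_smoothTransition : Continuous (deriv smoothTransition) :=
  (smoothTransition.contDiff (n := 1)).continuous_deriv (by norm_num)

lemma abs_deriv_cutoff_le {r : ℝ} (hr : 0 ≤ r) (x : ℝ) :
    |deriv (cutoff r) x| ≤ r * deriv smoothTransition (r * (π - x) - 1)
      + r * deriv smoothTransition (r * (x + π) - 1) := by
  have h1 : HasDerivAt (fun x => r * (π - x) - 1) (-r) x := by
    simpa using (((hasDerivAt_id x).const_sub π).const_mul r).sub_const 1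
  have h2 : HasDerivAt (fun x => r * (x + π) - 1) r x := by
    simpa using (((hasDerivAt_id x).add_const π).const_mul r).sub_const 1
  have h := ((hasDerivAt_smoothTransition _).comp x h1).mul
    ((hasDerivAt_smoothTransition _).comp x h2)
  have e : deriv (cutoff r) x = _ := h.deriv
  rw [e]
  refine (abs_add_le _ _).trans (add_le_add ?_ ?_)
  · simp only [Function.comp, abs_mul, abs_neg, abs_of_nonneg hr,
      abs_of_nonneg (deriv_smoothTransition_nonneg _), abs_of_nonneg (smoothTransition.nonneg _)]
    rw [mul_comm r (deriv smoothTransition _)]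
    exact mul_le_of_le_one_right (mul_nonneg (deriv_smoothTransition_nonneg _) hr)
      (smoothTransition.le_one _)
  · simp only [Function.comp, abs_mul, abs_of_nonneg hr,
      abs_of_nonneg (deriv_smoothTransition_nonneg _), abs_of_nonneg (smoothTransition.nonneg _)]
    rw [mul_comm r (deriv smoothTransition _)]
    exact mul_le_of_le_one_left (mul_nonneg (deriv_smoothTransition_nonneg _) hr)
      (smoothTransition.le_one _)

/-- The derivatives of the cutoffs do not see a continuous function with equal values at `±π`. -/
lemma tendsto_integral_mul_deriv_cutoff {f : ℝ → ℝ} (hf : Continuous f) (hb : f (-π) = f π) :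
    Tendsto (fun n : ℕ => ∫ x in (-π)..π, f x * deriv (cutoff n) x) atTop (𝓝 0) := by
  have hpi := pi_pos
  rw [Metric.tendsto_atTop']
  intro ε hε
  obtain ⟨δ₁, hδ₁, h₁⟩ := Metric.continuousAt_iff.1 (hf.continuousAt (x := π)) (ε / 3)
    (by positivity)
  obtain ⟨δ₂, hδ₂, h₂⟩ := Metric.continuousAt_iff.1 (hf.continuousAt (x := -π)) (ε / 3)
    (by positivity)
  obtain ⟨N, hN⟩ := exists_nat_gt (max 1 (2 / min δ₁ δ₂))
  refine ⟨N, fun n hn => ?_⟩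
  have hn' : max 1 (2 / min δ₁ δ₂) < (n : ℝ) := hN.trans (by exact_mod_cast hn)
  have hn1 : 1 < (n : ℝ) := (le_max_left _ _).trans_lt hn'
  have hnδ : 2 < n * min δ₁ δ₂ := by
    rw [← div_lt_iff₀ (lt_min hδ₁ hδ₂)]; exact (le_max_right _ _).trans_lt hn'
  have hnδ₁ : 2 < n * δ₁ := hnδ.trans_le (by gcongr; exact min_le_left _ _)
  have hnδ₂ : 2 < n * δ₂ := hnδ.trans_le (by gcongr; exact min_le_right _ _)
  have hcd : Continuous (deriv (cutoff n)) := (contDiff_cutoff n).continuous_deriv (by simp)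
  have hS := continuous_deriv_smoothTransition
  have hb0 : cutoff n π = 0 ∧ cutoff n (-π) = 0 := by
    simp [cutoff, smoothTransition.zero_of_nonpos]
  have hzero : ∫ x in (-π)..π, deriv (cutoff n) x = 0 := by
    rw [integral_deriv_eq_sub (fun x _ => (contDiff_cutoff n).differentiable (by simp) x)
      (hcd.intervalIntegrable _ _), hb0.1, hb0.2, sub_zero]
  -- Subtracting the common endpoint value makes the first factor small near both `π` and `-π`,
  -- where the cutoff derivative lives.
  have hsub : ∫ x in (-π)..π, f x * deriv (cutoff n) x =
      ∫ x in (-π)..π, (f x - f π) * deriv (cutoff n) x := by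
    simp_rw [sub_mul]
    rw [integral_sub (Continuous.intervalIntegrable (by fun_prop) _ _)
      (Continuous.intervalIntegrable (by fun_prop) _ _), intervalIntegral.integral_const_mul, hzero]
    ring
  -- The dominating function of `abs_deriv_cutoff_le` has mass `2` for every such `n`, so the final
  -- bound is `2ε/3`.
  have hmass : ∫ x in (-π)..π, (n * deriv smoothTransition (n * (π - x) - 1)
      + n * deriv smoothTransition (n * (x + π) - 1)) = 2 := by
    have hd : ∀ x ∈ uIcc (-π) π, HasDerivAt
        (fun x => smoothTransition (n * (x + π) - 1) - smoothTransition (n * (π - x) - 1))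
        (n * deriv smoothTransition (n * (π - x) - 1)
          + n * deriv smoothTransition (n * (x + π) - 1)) x := by
      intro x _
      have h1 : HasDerivAt (fun x : ℝ => n * (π - x) - 1) (-n : ℝ) x := by
        simpa using (((hasDerivAt_id x).const_sub π).const_mul (n : ℝ)).sub_const 1
      have h2 : HasDerivAt (fun x : ℝ => n * (x + π) - 1) (n : ℝ) x := by
        simpa using (((hasDerivAt_id x).add_const π).const_mul (n : ℝ)).sub_const 1
      refine (((hasDerivAt_smoothTransition _).comp x h2).sub
        ((hasDerivAt_smoothTransition _).comp x h1)).congr_deriv ?_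
      ring
    rw [integral_eq_sub_of_hasDerivAt hd (Continuous.intervalIntegrable (by fun_prop) _ _)]
    have e1 : smoothTransition (n * (π + π) - 1) = 1 :=
      smoothTransition.one_of_one_le (by nlinarith [pi_gt_three])
    have e2 : smoothTransition (n * (π - -π) - 1) = 1 := by rwa [sub_neg_eq_add]
    have e3 : smoothTransition (n * (π - π) - 1) = 0 := smoothTransition.zero_of_nonpos (by simp)
    have e4 : smoothTransition (n * (-π + π) - 1) = 0 := smoothTransition.zero_of_nonpos (by simp)
    rw [e1, e2, e3, e4]; norm_num
  rw [dist_zero_right, hsub]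
  have hle : ‖∫ x in (-π)..π, (f x - f π) * deriv (cutoff n) x‖ ≤
      ∫ x in (-π)..π, ε / 3 * (n * deriv smoothTransition (n * (π - x) - 1)
      + n * deriv smoothTransition (n * (x + π) - 1)) := by
    refine norm_integral_le_of_norm_le (by linarith) (ae_of_all _ fun x hx => ?_)
      (Continuous.intervalIntegrable (by fun_prop) _ _)
    rw [norm_mul, Real.norm_eq_abs, Real.norm_eq_abs]
    by_cases hx1 : dist x π < δ₁
    · refine mul_le_mul (by simpa [Real.dist_eq] using (h₁ hx1).le)
        (abs_deriv_cutoff_le (by linarith) x) (abs_nonneg _) (by positivity)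
    by_cases hx2 : dist x (-π) < δ₂
    · refine mul_le_mul (by simpa [Real.dist_eq, hb] using (h₂ hx2).le)
        (abs_deriv_cutoff_le (by linarith) x) (abs_nonneg _) (by positivity)
    · rw [Real.dist_eq, abs_of_nonpos (by linarith [hx.2])] at hx1
      rw [Real.dist_eq, abs_of_nonneg (by linarith [hx.1])] at hx2
      have h := abs_deriv_cutoff_le (by linarith : (0 : ℝ) ≤ n) x
      have z1 : 1 < n * (π - x) - 1 := by nlinarith
      have z2 : 1 < n * (x + π) - 1 := by nlinarith
      rw [deriv_smoothTransition_of_one_lt z1, deriv_smoothTransition_of_one_lt z2] at h ⊢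
      simp only [mul_zero, add_zero] at h ⊢
      rw [le_antisymm h (abs_nonneg _), mul_zero]
  rw [intervalIntegral.integral_const_mul, hmass] at hle
  linarith

/-- Integration by parts against smooth functions that need not vanish at the endpoints. -/
lemma IsWeakDeriv.integral_mul_deriv {u g φ : ℝ → ℝ} (h : IsWeakDeriv u g) (hg : MemLp g 2 volPi)
    (hu : Continuous u) (hφ : ContDiff ℝ ∞ φ) (hb : u (-π) * φ (-π) = u π * φ π) :
    ∫ x, u x * deriv φ x ∂volPi = - ∫ x, g x * φ x ∂volPi := by
  have hd : Continuous (deriv φ) := hφ.continuous_deriv (by simp)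
  have bdd : ∀ f : ℝ → ℝ, Continuous f → MemLp f 2 volPi :=
    fun f hf => memLp_volPi_of_continuous hf 2
  have lim : ∀ F : ℝ → ℝ, Integrable F volPi →
      Tendsto (fun n : ℕ => ∫ x, F x * cutoff n x ∂volPi) atTop (𝓝 (∫ x, F x ∂volPi)) := by
    intro F hF
    refine tendsto_integral_of_dominated_convergence (fun x => ‖F x‖)
      (fun n => hF.aestronglyMeasurable.mul (contDiff_cutoff n).continuous.aestronglyMeasurable)
      hF.norm (fun n => ae_of_all _ fun x => ?_) ?_
    · rw [norm_mul, Real.norm_eq_abs (cutoff _ _), abs_of_nonneg (cutoff_nonneg _ _)]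
      exact mul_le_of_le_one_right (norm_nonneg _) (cutoff_le_one _ _)
    · refine (ae_restrict_iff' measurableSet_Ioo).2 (ae_of_all _ fun x hx => ?_)
      simpa using (tendsto_cutoff hx).const_mul (F x)
  have hgφ : Integrable (fun x => g x * φ x) volPi := hg.integrable_mul (bdd φ hφ.continuous)
  have huφ : Integrable (fun x => u x * deriv φ x) volPi := (bdd u hu).integrable_mul (bdd _ hd)
  have l3 := tendsto_integral_mul_deriv_cutoff (f := fun x => u x * φ x)
    (hu.mul hφ.continuous) hb
  have key := ((lim _ huφ).add l3)
  rw [add_zero] at key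
  -- Test the weak derivative against `φ * cutoff n` and let `n → ∞`: the extra term, with the
  -- derivative on the cutoff, tends to `0`.
  refine tendsto_nhds_unique key ((lim _ hgφ).neg.congr' ?_)
  filter_upwards [eventually_gt_atTop 0] with n hn
  have hn' : (0 : ℝ) < n := by exact_mod_cast hn
  have hs : tsupport (fun x => φ x * cutoff n x) ⊆ Icc (-π + 1 / n) (π - 1 / n) :=
    (tsupport_mul_subset_right (f := φ) (g := cutoff n)).trans (tsupport_cutoff_subset hn')
  have hs' : Icc (-π + 1 / (n : ℝ)) (π - 1 / n) ⊆ Ioo (-π) π := fun x hx => by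
    have : 0 < 1 / (n : ℝ) := by positivity
    exact ⟨by linarith [hx.1], by linarith [hx.2]⟩
  have := h (fun x => φ x * cutoff n x) (hφ.mul (contDiff_cutoff n))
    (HasCompactSupport.of_support_subset_isCompact isCompact_Icc ((subset_tsupport _).trans hs))
    (hs.trans hs')
  have hcd : Continuous (deriv (cutoff n)) := (contDiff_cutoff n).continuous_deriv (by simp)
  have hcc : Continuous (cutoff n) := (contDiff_cutoff n).continuous
  have hderiv : ∀ x, u x * deriv (fun x => φ x * cutoff n x) x =
      u x * deriv φ x * cutoff n x + u x * φ x * deriv (cutoff n) x := by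
    intro x
    rw [deriv_fun_mul (hφ.differentiable (by simp) x)
      ((contDiff_cutoff n).differentiable (by simp) x)]
    ring
  simp_rw [hderiv, ← mul_assoc] at this
  have hφc := hφ.continuous
  have i1 : Integrable (fun x => u x * deriv φ x * cutoff n x) volPi :=
    (bdd _ (by fun_prop : Continuous fun x => u x * deriv φ x)).integrable_mul (bdd _ hcc)
  have i2 : Integrable (fun x => u x * φ x * deriv (cutoff n) x) volPi :=
    (bdd _ (by fun_prop : Continuous fun x => u x * φ x)).integrable_mul (bdd _ hcd)
  rw [integral_add i1 i2, integral_volPi (fun x => u x * φ x * deriv (cutoff n) x)] at this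
  exact this.symm

/-! ### Parseval and the Wirtinger inequality with constant `4` -/

lemma neg_pi_lt_pi : -π < π := by linarith [pi_pos]

lemma MemLp.integrable_mul_continuous {f φ : ℝ → ℝ} (hf : MemLp f 2 volPi) (hφ : Continuous φ) :
    Integrable (fun x => f x * φ x) volPi :=
  hf.integrable_mul (memLp_volPi_of_continuous hφ 2)

lemma norm_sq_fourierCoeffOn {f : ℝ → ℝ} (hf : MemLp f 2 volPi) (n : ℤ) :
    ‖fourierCoeffOn neg_pi_lt_pi (fun x => (f x : ℂ)) n‖ ^ 2 = (2 * π)⁻¹ ^ 2 *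
      ((∫ x, f x * cos (n * x) ∂volPi) ^ 2 + (∫ x, f x * sin (n * x) ∂volPi) ^ 2) := by
  have hpi := pi_pos
  have hc := MemLp.integrable_mul_continuous hf (φ := fun x => cos (n * x)) (by fun_prop)
  have hs := MemLp.integrable_mul_continuous hf (φ := fun x => sin (n * x)) (by fun_prop)
  have e : ∀ x : ℝ, fourier (-n) (x : AddCircle (π - -π)) • (f x : ℂ) =
      ((f x * cos (n * x) : ℝ) : ℂ) - ((f x * sin (n * x) : ℝ) : ℂ) * Complex.I := by
    intro x
    rw [fourier_coe_apply]
    have : 2 * (π : ℂ) * Complex.I * ((-n : ℤ) : ℂ) * (x : ℂ) / ((π - -π : ℝ) : ℂ) =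
        ((-(n * x) : ℝ) : ℂ) * Complex.I := by
      have : (π : ℂ) ≠ 0 := by exact_mod_cast hpi.ne'
      push_cast
      field_simp
      ring
    rw [this, Complex.exp_mul_I, ← Complex.ofReal_cos, ← Complex.ofReal_sin, cos_neg, sin_neg,
      smul_eq_mul]
    push_cast
    ring
  rw [fourierCoeffOn_eq_integral]
  simp_rw [e]
  rw [← integral_volPi, integral_sub hc.ofReal (hs.ofReal.mul_const _),
    MeasureTheory.integral_mul_const, integral_complex_ofReal, integral_complex_ofReal, norm_smul,
    mul_pow, Complex.sq_norm, Complex.normSq_apply]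
  simp
  field_simp
  ring

lemma hasSum_fourier_volPi {f : ℝ → ℝ} (hf : MemLp f 2 volPi) :
    HasSum (fun n : ℤ => (2 * π)⁻¹ ^ 2 *
      ((∫ x, f x * cos (n * x) ∂volPi) ^ 2 + (∫ x, f x * sin (n * x) ∂volPi) ^ 2))
      ((2 * π)⁻¹ * ∫ x, f x ^ 2 ∂volPi) := by
  have h2 : MemLp (fun x => (f x : ℂ)) 2 (volume.restrict (Ioc (-π) π)) := by
    rw [← restrict_Ioo_eq_restrict_Ioc]
    exact MemLp.ofReal hf
  have h := hasSum_sq_fourierCoeffOn neg_pi_lt_pi h2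
  simp_rw [norm_sq_fourierCoeffOn hf, Complex.norm_real, Real.norm_eq_abs, sq_abs] at h
  rwa [sub_neg_eq_add, ← two_mul, smul_eq_mul, ← integral_volPi] at h

/-- Integration by parts multiplies the squared `n`-th coefficient by `n²`. Modes with `|n| ≥ 2`
gain a factor at least `4`, the others vanish by the constraints, and Parseval sums the comparison.
-/
lemma MemW.four_mul_integral_sq_le {u g : ℝ → ℝ} (hu : MemW u) (hg : MemLp g 2 volPi)
    (hug : IsWeakDeriv u g) : 4 * ∫ x, u x ^ 2 ∂volPi ≤ ∫ x, g x ^ 2 ∂volPi := by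
  have hpi := pi_pos
  have hper : u (-π) = u π := by
    have := hu.periodic (-π)
    rw [← this]; congr 1; ring
  have hcos : ∀ n : ℤ, ∫ x, g x * cos (n * x) ∂volPi = n * ∫ x, u x * sin (n * x) ∂volPi := by
    intro n
    have h := hug.integral_mul_deriv hg hu.continuous (φ := fun x => cos (n * x))
      (by fun_prop) (by simp [hper])
    have hd : ∀ x : ℝ, u x * deriv (fun x => cos (n * x)) x = -n * (u x * sin (n * x)) := by
      intro x
      have := ((hasDerivAt_id' x).const_mul (n : ℝ)).cos.deriv
      rw [this]; ring
    simp_rw [hd, MeasureTheory.integral_const_mul] at h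
    linarith
  have hsin : ∀ n : ℤ, ∫ x, g x * sin (n * x) ∂volPi = -n * ∫ x, u x * cos (n * x) ∂volPi := by
    intro n
    have h := hug.integral_mul_deriv hg hu.continuous (φ := fun x => sin (n * x))
      (by fun_prop) (by simp [sin_int_mul_pi])
    have hd : ∀ x : ℝ, u x * deriv (fun x => sin (n * x)) x = n * (u x * cos (n * x)) := by
      intro x
      have := ((hasDerivAt_id' x).const_mul (n : ℝ)).sin.deriv
      rw [this]; ring
    simp_rw [hd, MeasureTheory.integral_const_mul] at h
    linarith
  have hle := hasSum_le (fun n => ?_) ((hasSum_fourier_volPi hu.memH1.1).mul_left 4)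
    (hasSum_fourier_volPi hg)
  · have : 0 < (2 * π)⁻¹ := by positivity
    nlinarith
  · rw [hcos, hsin]
    set C := ∫ x, u x * cos (n * x) ∂volPi with hC
    set S := ∫ x, u x * sin (n * x) ∂volPi with hS
    have h0 := hu.integral_eq_zero
    have h1 := hu.integral_mul_cos_eq_zero
    have h2 := hu.integral_mul_sin_eq_zero
    have hCS : 4 * (C ^ 2 + S ^ 2) ≤ n ^ 2 * (C ^ 2 + S ^ 2) := by
      by_cases hn : 2 ≤ |n|
      · have hn2 : (4 : ℤ) ≤ n ^ 2 := by rw [← sq_abs]; nlinarith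
        have : (4 : ℝ) ≤ n ^ 2 := by exact_mod_cast hn2
        gcongr
      · have hn' : |n| ≤ 1 := by omega
        obtain ⟨hl, hr⟩ := abs_le.1 hn'
        have hCz : C = 0 := by rw [hC]; interval_cases n <;> simp [h0, h1]
        have hSz : S = 0 := by
          rw [hS]; interval_cases n <;> simp [h2, MeasureTheory.integral_neg]
        simp [hCz, hSz]
    have : 0 ≤ (2 * π)⁻¹ ^ 2 := by positivity
    calc 4 * ((2 * π)⁻¹ ^ 2 * (C ^ 2 + S ^ 2)) = (2 * π)⁻¹ ^ 2 * (4 * (C ^ 2 + S ^ 2)) := by ring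
      _ ≤ (2 * π)⁻¹ ^ 2 * (n ^ 2 * (C ^ 2 + S ^ 2)) := by gcongr
      _ = _ := by ring

/-! ### Classical versus weak derivatives, and the competitor `cos 2x` -/

lemma isWeakDeriv_of_hasDerivAt {v v' : ℝ → ℝ} (hv : ∀ x, HasDerivAt v (v' x) x)
    (hc : Continuous v') : IsWeakDeriv v v' := by
  intro φ hφ _ hs
  have hz : φ π = 0 ∧ φ (-π) = 0 :=
    ⟨image_eq_zero_of_notMem_tsupport fun h => by simpa using hs h,
      image_eq_zero_of_notMem_tsupport fun h => by simpa using hs h⟩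
  rw [integral_volPi, integral_volPi, integral_mul_deriv_eq_deriv_mul (fun x _ => hv x)
    (fun x _ => (hφ.differentiable (by simp) x).hasDerivAt) (hc.intervalIntegrable _ _)
    ((hφ.continuous_deriv (by simp)).intervalIntegrable _ _), hz.1, hz.2]
  ring

/-- Needed because `weakDeriv` is an arbitrary choice: it lets `J` be computed from a classical
derivative. -/
lemma IsWeakDeriv.ae_eq {u g₁ g₂ : ℝ → ℝ} (h₁ : IsWeakDeriv u g₁) (h₂ : IsWeakDeriv u g₂)
    (hg₁ : MemLp g₁ 2 volPi) (hg₂ : MemLp g₂ 2 volPi) : g₁ =ᵐ[volPi] g₂ := by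
  have hint : Integrable (g₁ - g₂) volPi := (hg₁.sub hg₂).integrable (by norm_num)
  have h := isOpen_Ioo.ae_eq_zero_of_integral_contDiff_smul_eq_zero (μ := volume)
    (f := g₁ - g₂) (U := Ioo (-π) π) (IntegrableOn.locallyIntegrableOn hint) ?_
  · refine (ae_restrict_iff' measurableSet_Ioo).2 (h.mono fun x hx hxm => ?_)
    simpa [sub_eq_zero] using hx hxm
  · intro φ hφ hφc hφs
    have e : ∫ x, φ x • (g₁ - g₂) x = ∫ x, (g₁ x * φ x - g₂ x * φ x) ∂volPi := by
      rw [volPi, setIntegral_eq_integral_of_forall_compl_eq_zero]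
      · congr 1; ext x; simp; ring
      · intro x hx
        have : φ x = 0 := image_eq_zero_of_notMem_tsupport fun h => hx (hφs h)
        simp [this]
    rw [e, integral_sub (MemLp.integrable_mul_continuous hg₁ hφ.continuous)
      (MemLp.integrable_mul_continuous hg₂ hφ.continuous)]
    linarith [h₁ φ hφ hφc hφs, h₂ φ hφ hφc hφs]

lemma memH1_of_hasDerivAt {v v' : ℝ → ℝ} (hv : ∀ x, HasDerivAt v (v' x) x)
    (hc : Continuous v') : MemH1 v :=
  ⟨memLp_volPi_of_continuous (continuous_iff_continuousAt.2 fun x => (hv x).continuousAt) 2,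
    v', memLp_volPi_of_continuous hc 2, isWeakDeriv_of_hasDerivAt hv hc⟩

lemma hasDerivAt_cos_two_mul (x : ℝ) :
    HasDerivAt (fun x => cos (2 * x)) (-2 * sin (2 * x)) x :=
  (((hasDerivAt_id x).const_mul 2).cos).congr_deriv (by simp; ring)

lemma memW_cos_two_mul : MemW (fun x => cos (2 * x)) where
  continuous := by fun_prop
  periodic x := by
    simp only
    rw [show 2 * (x + 2 * π) = 2 * x + 2 * π + 2 * π by ring, cos_add_two_pi, cos_add_two_pi]
  memH1 := memH1_of_hasDerivAt hasDerivAt_cos_two_mul (by fun_prop)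
  integral_eq_zero := by
    rw [integral_volPi, integral_eq_sub_of_hasDerivAt (f := fun x => sin x * cos x)
      (fun x _ => ((hasDerivAt_sin x).mul (hasDerivAt_cos x)).congr_deriv (by
        rw [cos_two_mul']; ring)) (Continuous.intervalIntegrable (by fun_prop) _ _)]
    simp
  integral_mul_cos_eq_zero := by
    rw [integral_volPi, integral_eq_sub_of_hasDerivAt
      (f := fun x => sin x - 2 / 3 * sin x ^ 3)
      (fun x _ => ((hasDerivAt_sin x).sub (((hasDerivAt_sin x).pow 3).const_mul (2 / 3))).congr_deriv
        (by rw [cos_two_mul, cos_sq']; ring)) (Continuous.intervalIntegrable (by fun_prop) _ _)]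
    simp
  integral_mul_sin_eq_zero := by
    rw [integral_volPi, integral_eq_sub_of_hasDerivAt
      (f := fun x => cos x - 2 / 3 * cos x ^ 3)
      (fun x _ => ((hasDerivAt_cos x).sub (((hasDerivAt_cos x).pow 3).const_mul (2 / 3))).congr_deriv
        (by rw [cos_two_mul]; ring)) (Continuous.intervalIntegrable (by fun_prop) _ _)]
    simp

lemma integral_abs_cos_two_mul : ∫ x, |cos (2 * x)| ∂volPi = 4 := by
  have hpi := pi_pos
  have hp : Function.Periodic (fun x => |cos (2 * x)|) (π / 2) := fun x => by
    simp only
    rw [show 2 * (x + π / 2) = 2 * x + π by ring, cos_add_pi, abs_neg]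
  have h := hp.intervalIntegral_add_zsmul_eq 4 (-π)
    (fun _ _ => Continuous.intervalIntegrable (by fun_prop) _ _)
  -- Moves the period of length `π/2` to where `cos 2x` is nonnegative.
  rw [hp.intervalIntegral_add_eq (-π) (-(π / 4))] at h
  have e1 : -π + (4 : ℤ) • (π / 2) = π := by simp; ring
  have e2 : -(π / 4) + π / 2 = π / 4 := by ring
  rw [e1, e2] at h
  have h1 : ∫ x in (-(π / 4))..(π / 4), |cos (2 * x)| = ∫ x in (-(π / 4))..(π / 4), cos (2 * x) := by
    refine integral_congr fun x hx => abs_of_nonneg (cos_nonneg_of_mem_Icc ?_)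
    rw [uIcc_of_le (by linarith)] at hx
    constructor <;> linarith [hx.1, hx.2]
  have h2 : ∫ x in (-(π / 4))..(π / 4), cos (2 * x) = 1 := by
    rw [integral_comp_mul_left (fun x => cos x) two_ne_zero, integral_cos,
      show 2 * (π / 4) = π / 2 by ring, show 2 * (-(π / 4)) = -(π / 2) by ring, sin_neg, sin_pi_div_two]
    norm_num
  rw [integral_volPi, h, h1, h2]
  norm_num

lemma J_cos_two_mul : J (fun x => cos (2 * x)) = 3 * π / 16 := by
  have hd : IsWeakDeriv (fun x => cos (2 * x)) fun x => -2 * sin (2 * x) :=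
    isWeakDeriv_of_hasDerivAt hasDerivAt_cos_two_mul (by fun_prop)
  obtain ⟨hw2, hw⟩ := weakDeriv_spec memW_cos_two_mul.memH1
  have hae := hw.ae_eq hd hw2 (memLp_volPi_of_continuous (by fun_prop) 2)
  have hE : ∫ x, (weakDeriv (fun x => cos (2 * x)) x ^ 2 - cos (2 * x) ^ 2) ∂volPi = 3 * π := by
    rw [integral_congr_ae (g := fun x => (-2 * sin (2 * x)) ^ 2 - cos (2 * x) ^ 2)
      (hae.mono fun x hx => by simp only [hx]), integral_volPi,
      integral_eq_sub_of_hasDerivAt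
      (f := fun x => 3 / 2 * x - 5 / 4 * (sin (2 * x) * cos (2 * x)))
      (fun x _ => (((hasDerivAt_id x).const_mul (3 / 2)).sub
        (((((hasDerivAt_id x).const_mul 2).sin).mul (hasDerivAt_cos_two_mul x)).const_mul
        (5 / 4))).congr_deriv (by
          simp only [id]
          linear_combination (-3 / 2) * sin_sq_add_cos_sq (2 * x)))
      (Continuous.intervalIntegrable (by fun_prop) _ _)]
    simp
    ring
  rw [J, hE, integral_abs_cos_two_mul]
  norm_num

/-! ### Positivity of the norms and the final contradiction -/

lemma MemW.integral_comp_pos {u : ℝ → ℝ} (hu : MemW u) (h0 : u ≠ 0) {F : ℝ → ℝ}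
    (hF : Continuous F) (hF0 : ∀ y, 0 ≤ F y) (hFp : ∀ y, y ≠ 0 → 0 < F y) :
    0 < ∫ x, F (u x) ∂volPi := by
  have hc := hu.continuous
  obtain ⟨x₀, hx₀⟩ := Function.ne_iff.1 h0
  obtain ⟨y, hy, hxy⟩ := hu.periodic.exists_mem_Ico two_pi_pos x₀ (-π)
  rw [integral_volPi]
  refine integral_pos neg_pi_lt_pi (by fun_prop) (fun x _ => hF0 _) ⟨y, ⟨hy.1, ?_⟩, hFp _ ?_⟩
  · linarith [hy.2]
  · rwa [← hxy]

/-- The constraints and the conclusion are invariant under `u ↦ -u`, so the nonpositive case reduces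
to the nonnegative one. -/
lemma MemW.integral_abs_sq_le {u : ℝ → ℝ} (hu : MemW u) {a b : ℝ} (hab : IsNodalInterval u a b)
    (h : π ≤ b - a) :
    (∫ x, |u x| ∂volPi) ^ 2 ≤ (2 * π - 16 / (3 * π)) * ∫ x, u x ^ 2 ∂volPi := by
  have hsub : Ioo a (a + π) ⊆ Ioo a b := Ioo_subset_Ioo_right (by linarith)
  have h1 := hu.integral_eq_zero
  have h2 := hu.integral_mul_cos_eq_zero
  have h3 := hu.integral_mul_sin_eq_zero
  rw [integral_volPi] at h1 h2 h3 ⊢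
  rw [integral_volPi]
  rcases hab.2 with hp | hn
  · exact WirtingerL1.integral_abs_sq_le hu.continuous hu.periodic h1 h2 h3
      fun x hx => hp x (hsub hx)
  · have := WirtingerL1.integral_abs_sq_le (u := fun x => -u x) (a := a) hu.continuous.neg
      (fun x => by simp [hu.periodic x]) (by simp [h1]) (by simp [h2]) (by simp [h3])
      fun x hx => neg_nonneg.2 (hn x (hsub hx))
    simpa using this

end WirtingerL1

theorem mainTheorem4 (u : ℝ → ℝ) (hu : WirtingerL1.IsMinimizer u) (a b : ℝ)
    (hab : WirtingerL1.IsNodalInterval u a b) : b - a < π := by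
  by_contra! hle
  obtain ⟨⟨hW, h0⟩, hmin⟩ := hu
  have hpi := pi_pos
  have hJ : WirtingerL1.J u ≤ 3 * π / 16 := by
    rw [← WirtingerL1.J_cos_two_mul]
    exact hmin ⟨WirtingerL1.memW_cos_two_mul, fun h => by simpa using congrFun h 0⟩
  obtain ⟨hg, hug⟩ := WirtingerL1.weakDeriv_spec hW.memH1
  have hwirt := hW.four_mul_integral_sq_le hg hug
  have habs := hW.integral_abs_sq_le hab hle
  have hA := hW.integral_comp_pos h0 continuous_abs abs_nonneg fun y hy => abs_pos.2 hy
  have hU := hW.integral_comp_pos h0 (continuous_pow 2) sq_nonneg fun y hy => by positivity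
  rw [WirtingerL1.J, div_le_iff₀ (by positivity),
    integral_sub hg.integrable_sq hW.memH1.1.integrable_sq] at hJ
  set U := ∫ x, u x ^ 2 ∂WirtingerL1.volPi
  have h1 : 3 * U ≤ 3 * π / 16 * ((2 * π - 16 / (3 * π)) * U) :=
    (by linarith : 3 * U ≤ _).trans
      (mul_le_mul_of_nonneg_left habs (by positivity))
  have h2 : 3 * π / 16 * ((2 * π - 16 / (3 * π)) * U) = (3 * π ^ 2 / 8 - 1) * U := by
    field_simp
    ring
  rw [h2] at h1
  have h3 := le_of_mul_le_mul_right h1 hU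
  -- `3 ≤ 3π²/8 - 1` would force `π² ≥ 32/3`, while `π < 3.15`.
  nlinarith [pi_lt_d2, pi_gt_three]
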